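/- For $t\in\mathbb R$ let $\|t\|=|\operatorname{Arg} e^{it}|$, where $\operatorname{Arg}$ is the principal argument in $(-\pi,\pi]$. A vector $\xi=(\xi_1,\dots,\xi_s)$ of pairwise distinct nodes in $(-\frac{\pi}{2},\frac{\pi}{2}]$ forms a $(\Delta,\rho,s,\ell,\tau)$-clustered configuration, where $\Delta>0$, $2\le\ell\le s$, $\ell-1\le\tau\le\frac{\pi}{\Delta}$ and $\rho\ge 0$, if every $\xi_j$ belongs to a set $\xi^{(j)}\subset\{\xi_1,\dots,\xi_s\}$ of at most $\ell$ nodes such that $\Delta\le\|y-\xi_j\|\le\tau\Delta$ for all $y\in\xi^{(j)}\setminus\{\xi_j\}$, and $\|y-\xi_j\|\ge\rho$ for all nodes $y\notin\xi^{(j)}$. For $N\in\mathbb N$ let $U_N(\xi)$ be the $(2N+1)\times 2s$ confluent Vandermonde matrix \[ U_N(\xi)=\frac{1}{\sqrt{2N}}\big[\,z_j^k\quad k z_j^{k-1}\,\big]_{k=0,\dots,2N}^{j=1,\dots,s},\qquad z_j=e^{i\xi_j}, \] and let $\sigma_{\min}$ denote the smallest singular value. **Theorem 3.1.** For each $s\in\mathbb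 N$ there exists a constant $C_1=C_1(s)>0$, depending only on $s$, such that for all $\Delta,\rho,\ell,\tau$ with $4\tau\Delta\le\min\left(\rho,\frac{1}{s^2}\right)$, every $\xi=(\xi_1,\dots,\xi_s)\subset\frac{1}{s^2}\left(-\frac{\pi}{2},\frac{\pi}{2}\right]$ forming a $(\Delta,\rho,s,\ell,\tau)$-clustered configuration, and every $N\in\mathbb N$ satisfying \[ \max\left(\frac{4\pi s}{\rho},\,4s^3\right)\le N\le\frac{\pi s}{\tau\Delta}, \] one has \[ \sigma_{\min}(U_N(\xi))\ \ge\ C_1\cdot(N\Delta)^{2\ell-1}. \] -/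

import Mathlib

open scoped Real

noncomputable section

/-- The wraparound distance of `t` from `0`: the absolute value of the principal argument
(in `(-π, π]`) of `exp (i t)`. -/
def wrapNorm (t : ℝ) : ℝ :=
  |Complex.arg (Complex.exp (Complex.I * (t : ℂ)))|

/-- The normalized `(2N+1) × 2s` confluent Vandermonde matrix with nodes `z j = exp (i ξ j)`.
Rows are indexed by `k = 0, …, 2N`; the columns `(j, 0)` and `(j, 1)` are the pair
`[z j ^ k,  k * z j ^ (k - 1)]` belonging to the node `ξ j`. In the row `k = 0` the truncated
exponent is harmless, since the factor `k` makes that entry `0`. -/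
def confluentVandermonde {s : ℕ} (N : ℕ) (ξ : Fin s → ℝ) :
    Matrix (Fin (2 * N + 1)) (Fin s × Fin 2) ℂ :=
  Matrix.of fun k c =>
    ((1 / √(2 * (N : ℝ)) : ℝ) : ℂ) *
      (if c.2 = 0 then Complex.exp (Complex.I * (ξ c.1 : ℂ)) ^ (k : ℕ)
        else ((k : ℕ) : ℂ) * Complex.exp (Complex.I * (ξ c.1 : ℂ)) ^ ((k : ℕ) - 1))

/-- The smallest singular value of a complex matrix, i.e. the `min(m, n)`-th one in decreasing
order (Mathlib's sequence of singular values is decreasing and starts at index `0`). -/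
def sigmaMin {m n : Type*} [Fintype m] [Fintype n] [DecidableEq n] (A : Matrix m n ℂ) : ℝ :=
  (Matrix.toEuclideanLin A).singularValues (min (Fintype.card m) (Fintype.card n) - 1)

/-- The node vector `x` of `s` pairwise distinct nodes in `(-π/2, π/2]` forms a
`(Δ, ρ, s, ℓ, τ)`-clustered configuration. -/
structure IsClusteredConfiguration (Δ ρ : ℝ) (s ℓ : ℕ) (τ : ℝ) (x : Fin s → ℝ) : Prop where
  Δ_pos : 0 < Δ
  two_le_ℓ : 2 ≤ ℓ
  ℓ_le_s : ℓ ≤ s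
  le_τ : (ℓ : ℝ) - 1 ≤ τ
  τ_le : τ ≤ π / Δ
  ρ_nonneg : 0 ≤ ρ
  mem_Ioc : ∀ j, x j ∈ Set.Ioc (-(π / 2)) (π / 2)
  injective : Function.Injective x
  /-- Every node `x j` has a cluster `c` of at most `ℓ` nodes containing it, whose other members
  are at distance between `Δ` and `τ Δ` from it, all nodes outside being at distance at
  least `ρ`. -/
  cluster : ∀ j, ∃ c : Finset (Fin s), j ∈ c ∧ c.card ≤ ℓ ∧
    (∀ k ∈ c, k ≠ j → Δ ≤ wrapNorm (x k - x j) ∧ wrapNorm (x k - x j) ≤ τ * Δ) ∧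
    (∀ k, k ∉ c → ρ ≤ wrapNorm (x k - x j))

end

/-! The proof is by duality. If `P` has degree at most `2N`, pairing its coefficient vector with `U
x` evaluates `P` and `P'` at the nodes. Prescribing value and derivative at one node and double
zeros at the others therefore isolates a single entry of `x`. By Cauchy–Schwarz that entry is at
most `3 N M ‖U x‖`, where `M` bounds the coefficients of `P` (`norm_le_of_hermite_interpolant`).

To keep `M` small, `P` is built from polynomials in `X ^ q` with `q` of order `N / s`. Raising nodes
to the power `q` spreads a cluster to scale `N Δ`, and a counting argument (`exists_decimation`)
finds a `q` for which no outside node collides with the chosen one. A factor `X ^ q - w` with `‖w‖ =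
1` at most doubles the coefficients, so the cost is governed by the inverse separations: two for
each of at most `ℓ - 1` cluster neighbours and one for adjusting the derivative. This gives the
exponent `2ℓ - 1`. An averaging factor contributes `1 / q`, which cancels the `N` above
(`exists_hermite_interpolant`). -/

/-- A linear map that expands every vector by at least `C` has all its (nontrivial) singular
values at least `C`. -/
theorem le_singularValues_of_forall_norm_le {E F : Type*}
    [NormedAddCommGroup E] [InnerProductSpace ℂ E] [FiniteDimensional ℂ E]
    [NormedAddCommGroup F] [InnerProductSpace ℂ F] [FiniteDimensional ℂ F]
    (T : E →ₗ[ℂ] F) {C : ℝ} (hC : ∀ x, C * ‖x‖ ≤ ‖T x‖) {n : ℕ}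
    (hn : n < Module.finrank ℂ E) : C ≤ T.singularValues n := by
  obtain ⟨v, hv⟩ := (T.hasEigenvalue_adjoint_comp_self_sq_singularValues hn).exists_hasEigenvector
  have h1 := hv.apply_eq_smul
  have hv0 : 0 < ‖v‖ := norm_pos_iff.2 hv.2
  have h2 : ‖T v‖ ^ 2 = (T.singularValues n * ‖v‖) ^ 2 := by
    have h3 : inner ℂ ((LinearMap.adjoint T ∘ₗ T) v) v = inner ℂ (T v) (T v) := by
      rw [LinearMap.comp_apply, LinearMap.adjoint_inner_left]
    rw [h1, inner_smul_left, inner_self_eq_norm_sq_to_K, inner_self_eq_norm_sq_to_K] at h3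
    have h4 := congrArg Complex.re h3
    simp only [map_pow, Complex.conj_ofReal, Complex.coe_algebraMap] at h4
    norm_cast at h4
    rw [← h4]; ring
  have h5 : ‖T v‖ = T.singularValues n * ‖v‖ := by
    have := T.singularValues_nonneg n
    exact (sq_eq_sq₀ (norm_nonneg _) (by positivity)).1 h2
  exact le_of_mul_le_mul_right (h5 ▸ hC v) hv0

/-! ### Counting integers and choosing the decimation factor. -/

theorem card_Icc_ceil_floor_le {u v : ℝ} (h : u ≤ v) :
    ((Finset.Icc ⌈u⌉ ⌊v⌋).card : ℝ) ≤ v - u + 1 := by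
  rw [Int.card_Icc]
  have h1 := Int.floor_le v
  have h2 := Int.le_ceil u
  rcases le_total 0 (⌊v⌋ + 1 - ⌈u⌉) with h3 | h3
  · have h4 : (((⌊v⌋ + 1 - ⌈u⌉).toNat : ℤ) : ℝ) = ((⌊v⌋ + 1 - ⌈u⌉ : ℤ) : ℝ) := by
      rw [Int.toNat_of_nonneg h3]
    push_cast at h4
    rw [h4]; linarith
  · rw [Int.toNat_of_nonpos h3]; push_cast; linarith

theorem le_card_Icc_ceil_floor (u v : ℝ) :
    v - u - 1 ≤ ((Finset.Icc ⌈u⌉ ⌊v⌋).card : ℝ) := by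
  rw [Int.card_Icc]
  have h1 := Int.lt_floor_add_one v
  have h2 := Int.ceil_lt_add_one u
  have h4 : ((⌊v⌋ + 1 - ⌈u⌉ : ℤ) : ℝ) ≤ (((⌊v⌋ + 1 - ⌈u⌉).toNat : ℤ) : ℝ) := by
    exact_mod_cast Int.self_le_toNat _
  push_cast at h4
  linarith

/-- The number of integers `q ∈ [u, v]` for which `q x` is `ε`-close to an integer. -/
theorem card_filter_near_integer_le {u v x ε : ℝ} (huv : u ≤ v) (hx : 0 < x) (hε : 0 < ε)
    (t : Finset ℤ)
    (ht : ∀ q ∈ t, q ∈ Finset.Icc ⌈u⌉ ⌊v⌋ ∧ ∃ m : ℤ, |(q : ℝ) * x - m| < ε) :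
    (t.card : ℝ) ≤ (2 * ε / x + 1) * ((v - u) * x + 2 * ε + 1) := by
  classical
  -- If `q x` is `ε`-close to `m`, then `q` lies in an interval of length `2ε / x` about `m / x`,
  -- and `m` lies in `[u x - ε, v x + ε]`.
  have hsub : t ⊆ (Finset.Icc ⌈u * x - ε⌉ ⌊v * x + ε⌋).biUnion
      fun m => Finset.Icc ⌈((m : ℝ) - ε) / x⌉ ⌊((m : ℝ) + ε) / x⌋ := by
    intro q hq
    obtain ⟨hq1, m, hm⟩ := ht q hq
    rw [Finset.mem_Icc, Int.ceil_le, Int.le_floor] at hq1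
    rw [abs_lt] at hm
    have h1 := mul_le_mul_of_nonneg_right hq1.1 hx.le
    have h2 := mul_le_mul_of_nonneg_right hq1.2 hx.le
    rw [Finset.mem_biUnion]
    refine ⟨m, ?_, ?_⟩
    · rw [Finset.mem_Icc, Int.ceil_le, Int.le_floor]
      constructor <;> linarith
    · rw [Finset.mem_Icc, Int.ceil_le, Int.le_floor, div_le_iff₀ hx, le_div_iff₀ hx]
      constructor <;> linarith
  have h1 : (t.card : ℝ) ≤ ∑ m ∈ Finset.Icc ⌈u * x - ε⌉ ⌊v * x + ε⌋,
      ((Finset.Icc ⌈((m : ℝ) - ε) / x⌉ ⌊((m : ℝ) + ε) / x⌋).card : ℝ) := by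
    exact_mod_cast (Finset.card_le_card hsub).trans Finset.card_biUnion_le
  refine h1.trans ?_
  have h2 : ∀ m ∈ Finset.Icc ⌈u * x - ε⌉ ⌊v * x + ε⌋,
      ((Finset.Icc ⌈((m : ℝ) - ε) / x⌉ ⌊((m : ℝ) + ε) / x⌋).card : ℝ) ≤ 2 * ε / x + 1 := by
    intro m _
    refine (card_Icc_ceil_floor_le (by gcongr; linarith)).trans (le_of_eq ?_)
    field_simp; ring
  refine (Finset.sum_le_card_nsmul _ _ _ h2).trans ?_
  rw [nsmul_eq_mul, mul_comm]
  gcongr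
  have h3 := mul_le_mul_of_nonneg_right huv hx.le
  refine (card_Icc_ceil_floor_le (by linarith)).trans (le_of_eq ?_)
  ring

/-- A decimation factor `q ∈ [N / (2s), N / s]` that keeps finitely many normalized frequencies
away from the integers. -/
theorem exists_decimation {ι : Type*} {s N : ℕ} (hs : 2 ≤ s) (hN : 4 * (s : ℝ) ^ 3 ≤ N)
    (t : Finset ι) (ht : t.card + 1 ≤ s) (x : ι → ℝ)
    (hx : ∀ i ∈ t, 2 * (s : ℝ) / N ≤ x i ∧ x i ≤ 1 / (2 * (s : ℝ) ^ 2)) :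
    ∃ q : ℕ, (N : ℝ) / (2 * s) ≤ q ∧ (q : ℝ) ≤ N / s ∧
      ∀ i ∈ t, ∀ m : ℤ, 1 / (24 * (s : ℝ)) ≤ |(q : ℝ) * x i - m| := by
  classical
  have hs' : (2 : ℝ) ≤ s := by exact_mod_cast hs
  have hN0 : (0 : ℝ) < N := lt_of_lt_of_le (by positivity) hN
  have ht' : (t.card : ℝ) + 1 ≤ s := by exact_mod_cast ht
  set u : ℝ := (N : ℝ) / (2 * s) with hu
  set v : ℝ := (N : ℝ) / s with hv
  set ε : ℝ := 1 / (24 * (s : ℝ)) with hε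
  have hε0 : 0 < ε := by positivity
  have hu0 : 0 < u := by positivity
  have hvu : v = 2 * u := by rw [hu, hv]; field_simp
  by_contra! hcon
  -- If every `q` fails, the at most `s - 1` bad sets cover all integers of `[u, 2u]`, of which
  -- there are at least `u - 1`.
  let bad : ι → Finset ℤ := fun i =>
    (Finset.Icc ⌈u⌉ ⌊v⌋).filter fun q => ∃ m : ℤ, |(q : ℝ) * x i - m| < ε
  have hcover : Finset.Icc ⌈u⌉ ⌊v⌋ ⊆ t.biUnion bad := by
    intro q hq
    have hq' := hq
    rw [Finset.mem_Icc, Int.ceil_le, Int.le_floor] at hq'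
    have hq0 : (0 : ℝ) ≤ q := hu0.le.trans hq'.1
    lift q to ℕ using (by exact_mod_cast hq0)
    obtain ⟨i, hi, m, hm⟩ := hcon q (by exact_mod_cast hq'.1) (by exact_mod_cast hq'.2)
    rw [Finset.mem_biUnion]
    exact ⟨i, hi, Finset.mem_filter.2 ⟨hq, m, by exact_mod_cast hm⟩⟩
  have hbad : ∀ i ∈ t, ((bad i).card : ℝ) ≤ u / (4 * s) + u / (2 * s ^ 2) + 2 := by
    intro i hi
    obtain ⟨hx1, hx2⟩ := hx i hi
    have hx0 : 0 < x i := lt_of_lt_of_le (by positivity) hx1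
    have h := card_filter_near_integer_le (u := u) (v := v) (by linarith) hx0 hε0 (bad i)
      (fun q hq => Finset.mem_filter.1 hq)
    refine h.trans ?_
    have h1 : 1 / x i ≤ u / s * s := by
      rw [div_le_iff₀ hx0, hu]
      rw [div_le_iff₀ hN0] at hx1
      field_simp
      linarith
    have h1' : ε / x i ≤ u / (24 * s) := by
      calc ε / x i = ε * (1 / x i) := by ring
        _ ≤ ε * (u / s * s) := by gcongr
        _ = u / (24 * s) := by rw [hε]; field_simp
    have h2 : u * x i ≤ u / (2 * s ^ 2) := by
      calc u * x i ≤ u * (1 / (2 * (s : ℝ) ^ 2)) := by gcongr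
        _ = _ := by ring
    have h3 : ε ≤ 1 / 48 := by
      rw [hε, div_le_div_iff₀ (by positivity) (by positivity)]; linarith
    have h4 : ε * u = u / (24 * s) := by rw [hε]; field_simp
    have h5 : 0 < ε / x i := by positivity
    have h6 : (2 * ε / x i + 1) * ((v - u) * x i + 2 * ε + 1)
        = 2 * (ε * u) + 4 * (ε / x i) * ε + 2 * (ε / x i) + u * x i + 2 * ε + 1 := by
      rw [hvu]; field_simp; ring
    have h7 : 4 * (ε / x i) * ε ≤ 4 * (ε / x i) * (1 / 48) := by gcongr
    have h8 : u / (4 * s) = 6 * (u / (24 * s)) := by field_simp; norm_num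
    rw [h6, h4, h8]
    linarith
  have hcount : u - 1 ≤ t.card * (u / (4 * s) + u / (2 * s ^ 2) + 2) := by
    have h1 := le_card_Icc_ceil_floor u v
    have h2 : ((Finset.Icc ⌈u⌉ ⌊v⌋).card : ℝ) ≤ ∑ i ∈ t, ((bad i).card : ℝ) := by
      exact_mod_cast (Finset.card_le_card hcover).trans Finset.card_biUnion_le
    have h3 := Finset.sum_le_card_nsmul _ _ _ hbad
    rw [nsmul_eq_mul] at h3
    linarith
  -- Here `N ≥ 4 s³` enters: the bad sets hold at most `(s - 1) (u / (2s) + 2)` integers, which is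
  -- below `u - 1` once `u ≥ 2 s²`.
  have hu2 : 2 * (s : ℝ) ^ 2 ≤ u := by
    rw [hu, le_div_iff₀ (by positivity)]; linarith
  have h9 : (t.card : ℝ) * (u / (4 * s) + u / (2 * s ^ 2) + 2)
      ≤ (s - 1) * (u / (4 * s) + u / (2 * s ^ 2) + 2) := by
    gcongr; linarith
  have h10 : u / (4 * s) + u / (2 * s ^ 2) ≤ u / (2 * s) := by
    have : u / (2 * s ^ 2) ≤ u / (4 * s) := by
      exact div_le_div_of_nonneg_left hu0.le (by positivity) (by nlinarith)
    have h : u / (2 * s) = u / (4 * s) + u / (4 * s) := by field_simp; norm_num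
    linarith
  have h11 : (s - 1 : ℝ) * (u / (4 * s) + u / (2 * s ^ 2) + 2) ≤ (s - 1) * (u / (2 * s) + 2) := by
    gcongr; linarith
  have h12 : (s : ℝ) * (u / (2 * s)) = u / 2 := by field_simp
  have h13 : 0 < u / (2 * s) := by positivity
  nlinarith

/-! ### Chords and angles on the unit circle. -/

theorem norm_exp_sub_exp_eq (x y : ℝ) :
    ‖Complex.exp (Complex.I * x) - Complex.exp (Complex.I * y)‖ = 2 * |Real.sin ((y - x) / 2)| := by
  have h : Complex.exp (Complex.I * x) - Complex.exp (Complex.I * y)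
      = - (Complex.exp (Complex.I * x) * (Complex.exp (Complex.I * ((y - x : ℝ) : ℂ)) - 1)) := by
    rw [mul_sub, ← Complex.exp_add]; push_cast; ring_nf
  rw [h, norm_neg, norm_mul, Complex.norm_exp_I_mul_ofReal_sub_one, mul_comm Complex.I,
    Complex.norm_exp_ofReal_mul_I, one_mul, norm_mul, Real.norm_eq_abs, Real.norm_eq_abs,
    abs_of_pos (by norm_num : (0 : ℝ) < 2)]

/-- Subtracting the nearest integer does not change `|sin (π y)|`, and Jordan's inequality then
applies. -/
theorem le_abs_sin_pi_mul_of_far_from_integers {y ε : ℝ} (h : ∀ m : ℤ, ε ≤ |y - m|) :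
    2 * ε ≤ |Real.sin (π * y)| := by
  have h1 : |y - round y| ≤ 1 / 2 := abs_sub_round y
  have h2 := Real.mul_abs_le_abs_sin (x := π * y - round y * π) (by
    rw [show π * y - round y * π = π * (y - round y) by ring, abs_mul, abs_of_pos Real.pi_pos]
    nlinarith [Real.pi_pos])
  rw [Real.sin_sub_int_mul_pi, abs_mul, abs_zpow, abs_neg, abs_one, one_zpow, one_mul,
    show π * y - round y * π = π * (y - round y) by ring, abs_mul, abs_of_pos Real.pi_pos] at h2
  have h3 : 2 / π * (π * |y - round y|) = 2 * |y - round y| := by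
    field_simp
  linarith [h (round y)]

theorem wrapNorm_eq_abs {t : ℝ} (h : |t| < π) : wrapNorm t = |t| := by
  rw [abs_lt] at h
  rw [wrapNorm, mul_comm, Complex.arg_exp_mul_I, (toIocMod_eq_self Real.two_pi_pos).2]
  constructor <;> linarith

/-! ### Polynomials with controlled coefficients. -/

open Polynomial in
theorem sum_coeff_mul_eq_eval (P : ℂ[X]) {n : ℕ} (hP : P.natDegree < n) (z : ℂ) :
    ∑ k : Fin n, P.coeff k * z ^ (k : ℕ) = P.eval z := by
  rw [P.eval_eq_sum_range' hP, Finset.sum_range]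

open Polynomial in
theorem sum_coeff_mul_eq_derivative_eval (P : ℂ[X]) {n : ℕ} (hP : P.natDegree < n) (z : ℂ) :
    ∑ k : Fin n, P.coeff k * ((k : ℕ) * z ^ ((k : ℕ) - 1)) = P.derivative.eval z := by
  rw [P.derivative_eval, P.sum_over_range' _ _ hP, Finset.sum_range]
  · simp only [mul_assoc]
  · simp

open Polynomial in
theorem norm_coeff_C_mul_le {P : ℂ[X]} {B : ℝ} (hP : ∀ n, ‖P.coeff n‖ ≤ B) (a : ℂ) (n : ℕ) :
    ‖(C a * P).coeff n‖ ≤ ‖a‖ * B := by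
  rw [coeff_C_mul, norm_mul]
  exact mul_le_mul_of_nonneg_left (hP n) (norm_nonneg _)

-- `X ^ q` shifts the coefficients and `w` rotates them, so a new coefficient is a difference of two
-- old ones up to phase; the loss does not depend on the degree.
open Polynomial in
theorem norm_coeff_X_pow_sub_C_mul_le {P : ℂ[X]} {B : ℝ} (hP : ∀ n, ‖P.coeff n‖ ≤ B) {w : ℂ}
    (hw : ‖w‖ = 1) (q n : ℕ) : ‖((X ^ q - C w) * P).coeff n‖ ≤ 2 * B := by
  have hB : 0 ≤ B := (norm_nonneg _).trans (hP 0)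
  have h1 : ‖(X ^ q * P).coeff n‖ ≤ B := by
    rw [coeff_X_pow_mul']
    split_ifs
    · exact hP _
    · simpa using hB
  have h2 := norm_coeff_C_mul_le hP w n
  rw [sub_mul, coeff_sub]
  refine (norm_sub_le _ _).trans ?_
  rw [hw, one_mul] at h2
  linarith

open Polynomial in
theorem norm_coeff_prod_mul_le {ι : Type*} {P : ℂ[X]} {B : ℝ} (hP : ∀ n, ‖P.coeff n‖ ≤ B)
    (t : Finset ι) (a w : ι → ℂ) (r : ι → ℝ) (hw : ∀ k ∈ t, ‖w k‖ = 1)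
    (ha : ∀ k ∈ t, ‖a k‖ ≤ r k) (q n : ℕ) :
    ‖((∏ k ∈ t, (C (a k) * (X ^ q - C (w k))) ^ 2) * P).coeff n‖
      ≤ (∏ k ∈ t, (2 * r k) ^ 2) * B := by
  classical
  have hB : 0 ≤ B := (norm_nonneg _).trans (hP 0)
  induction t using Finset.induction_on generalizing n with
  | empty => simpa using hP n
  | insert k t hk ih =>
    rw [Finset.forall_mem_insert] at hw ha
    have h := norm_coeff_C_mul_le (norm_coeff_X_pow_sub_C_mul_le (norm_coeff_C_mul_le
      (norm_coeff_X_pow_sub_C_mul_le (ih hw.2 ha.2) hw.1 q) (a k)) hw.1 q) (a k) n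
    rw [Finset.prod_insert hk, Finset.prod_insert hk]
    have hB' : 0 ≤ (∏ k ∈ t, (2 * r k) ^ 2) * B :=
      mul_nonneg (Finset.prod_nonneg fun _ _ => sq_nonneg _) hB
    calc _ = _ := by congr 2; ring
      _ ≤ _ := h
      _ = (2 * ‖a k‖) ^ 2 * ((∏ k ∈ t, (2 * r k) ^ 2) * B) := by ring
      _ ≤ (2 * r k) ^ 2 * ((∏ k ∈ t, (2 * r k) ^ 2) * B) := by
        have := ha.1
        gcongr
      _ = _ := by ring

/-- The averaging polynomial `q⁻¹ ∑_{m < q} (X / z) ^ m`. -/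
noncomputable def averagingPolynomial (q : ℕ) (z : ℂ) : Polynomial ℂ :=
  ∑ m ∈ Finset.range q, Polynomial.monomial m ((q : ℂ)⁻¹ * z⁻¹ ^ m)

section
variable {q : ℕ} {z : ℂ}

theorem natDegree_averagingPolynomial_le : (averagingPolynomial q z).natDegree ≤ q - 1 := by
  refine Polynomial.natDegree_sum_le_of_forall_le _ _ fun m hm => ?_
  rw [Finset.mem_range] at hm
  exact (Polynomial.natDegree_monomial_le _).trans (by omega)

theorem norm_coeff_averagingPolynomial_le (hz : ‖z‖ = 1) (n : ℕ) :
    ‖(averagingPolynomial q z).coeff n‖ ≤ (q : ℝ)⁻¹ := by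
  simp only [averagingPolynomial, Polynomial.finsetSum_coeff, Polynomial.coeff_monomial,
    Finset.sum_ite_eq', Finset.mem_range]
  split_ifs
  · simp [hz]
  · simp

theorem eval_averagingPolynomial (hq : q ≠ 0) (hz : z ≠ 0) :
    (averagingPolynomial q z).eval z = 1 := by
  have : (q : ℂ) ≠ 0 := by exact_mod_cast hq
  simp only [averagingPolynomial, Polynomial.eval_finsetSum, Polynomial.eval_monomial]
  rw [Finset.sum_congr rfl (g := fun _ => (q : ℂ)⁻¹)]
  · simp [this]
  · intro m _
    rw [mul_assoc, ← mul_pow, inv_mul_cancel₀ hz, one_pow, mul_one]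

theorem norm_eval_derivative_averagingPolynomial_le (hq : q ≠ 0) (hz : ‖z‖ = 1) :
    ‖(averagingPolynomial q z).derivative.eval z‖ ≤ q := by
  have hq' : (0 : ℝ) < q := by exact_mod_cast Nat.pos_of_ne_zero hq
  simp only [averagingPolynomial, Polynomial.derivative_sum, Polynomial.derivative_monomial,
    Polynomial.eval_finsetSum, Polynomial.eval_monomial]
  refine (norm_sum_le _ _).trans ((Finset.sum_le_card_nsmul _ _ 1 ?_).trans (by simp))
  intro m hm
  rw [Finset.mem_range] at hm
  have hm' : (m : ℝ) ≤ q := by exact_mod_cast hm.le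
  simp only [norm_mul, norm_inv, norm_pow, hz, Complex.norm_natCast, inv_one, one_pow, mul_one]
  rw [inv_mul_le_iff₀ hq']
  linarith

end

/-! ### Hermite interpolation through `q`-th powers. -/

open Polynomial in
/-- Hermite interpolation at one of several unimodular nodes, by a polynomial with small
coefficients, when the `q`-th powers of the nodes are separated. -/
theorem exists_hermite_interpolant {ι : Type*} [Fintype ι] [DecidableEq ι] {q N : ℕ} (hq : q ≠ 0)
    (hqN : Fintype.card ι * q ≤ N) (z : ι → ℂ) (hz : ∀ k, ‖z k‖ = 1) (j : ι) (r : ι → ℝ)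
    (hsep : ∀ k, k ≠ j → z j ^ q ≠ z k ^ q)
    (hr : ∀ k, k ≠ j → ‖z j ^ q - z k ^ q‖⁻¹ ≤ r k) (α β : ℂ) :
    ∃ P : ℂ[X], P.natDegree ≤ 2 * N ∧
      (∀ k, P.eval (z k) = if k = j then α else 0) ∧
      (∀ k, P.derivative.eval (z k) = if k = j then β else 0) ∧
      ∀ n, ‖P.coeff n‖ ≤ (∏ k ∈ Finset.univ.erase j, (2 * r k) ^ 2) *
        ((‖α‖ + 2 * (‖β‖ + ‖α‖ * (2 * ∑ k ∈ Finset.univ.erase j, r k + 1))) * (q : ℝ)⁻¹) := by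
  set t := Finset.univ.erase j with ht
  have hq0 : (0 : ℝ) < q := by exact_mod_cast Nat.pos_of_ne_zero hq
  have hq1 : (1 : ℝ) ≤ q := by exact_mod_cast Nat.one_le_iff_ne_zero.2 hq
  have hqC : (q : ℂ) ≠ 0 := by exact_mod_cast hq
  have hz0 : ∀ k, z k ≠ 0 := fun k h => by simpa [h] using hz k
  let w : ι → ℂ := fun k => z k ^ q
  let a : ι → ℂ := fun k => (w j - w k)⁻¹
  have hw : ∀ k, ‖w k‖ = 1 := fun k => by simp [w, hz]
  let F : ι → ℂ[X] := fun k => C (a k) * (X ^ q - C (w k))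
  let G : ℂ[X] := ∏ k ∈ t, F k ^ 2
  have hFj : ∀ k ∈ t, (F k).eval (z j) = 1 := by
    intro k hk
    have : w j - w k ≠ 0 := sub_ne_zero.2 (hsep k (Finset.ne_of_mem_erase hk))
    simp only [F, a, eval_mul, eval_C, eval_sub, eval_pow, eval_X]
    exact inv_mul_cancel₀ this
  have hGj : G.eval (z j) = 1 := by
    simp only [G, eval_prod, eval_pow]
    exact Finset.prod_eq_one fun k hk => by rw [hFj k hk, one_pow]
  have hG'j : ‖G.derivative.eval (z j)‖ ≤ q * (2 * ∑ k ∈ t, r k) := by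
    -- All factors equal `1` at `z j`, so the product rule leaves only the sum of the derivatives of
    -- the squares.
    have h1 : G.derivative.eval (z j) = ∑ k ∈ t, 2 * (a k * (q * z j ^ (q - 1))) := by
      simp only [G, derivative_prod_finset, eval_finsetSum, eval_mul, eval_prod, eval_pow]
      refine Finset.sum_congr rfl fun k hk => ?_
      rw [Finset.prod_eq_one fun i hi => by
        rw [hFj i (Finset.mem_of_mem_erase hi), one_pow]]
      rw [derivative_pow, one_mul, eval_mul, eval_mul, eval_pow, hFj k hk]
      simp [F, derivative_X_pow]
    rw [h1, Finset.mul_sum, Finset.mul_sum]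
    refine (norm_sum_le _ _).trans (Finset.sum_le_sum fun k hk => ?_)
    have h2 : ‖a k‖ ≤ r k := by
      simp only [a, norm_inv]; exact hr k (Finset.ne_of_mem_erase hk)
    simp only [norm_mul, norm_pow, hz, one_pow, Complex.norm_natCast, mul_one, Complex.norm_ofNat]
    nlinarith
  have hGk : ∀ k, k ≠ j → (X - C (z k)) ^ 2 ∣ G := by
    intro k hk
    have h1 : (X - C (z k)) ∣ F k := by
      rw [dvd_iff_isRoot]
      simp [F, w]
    exact (pow_dvd_pow_of_dvd h1 2).trans
      (Finset.dvd_prod_of_mem (fun k => F k ^ 2) (Finset.mem_erase.2 ⟨hk, Finset.mem_univ _⟩))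
  -- `D` imposes no zero; its role is to have value `1` at `z j` with coefficients of size only `1 /
  -- q`.
  let D := averagingPolynomial q (z j)
  have hDj : D.eval (z j) = 1 := eval_averagingPolynomial hq (hz0 j)
  let e : ℂ := G.derivative.eval (z j) + D.derivative.eval (z j)
  have he : ‖e‖ ≤ q * (2 * ∑ k ∈ t, r k + 1) := by
    have := norm_eval_derivative_averagingPolynomial_le hq (hz j)
    refine (norm_add_le _ _).trans ?_
    simp only [D]
    linarith
  -- Chosen so that the derivative `α e + b q z_j ^ (q - 1)` of `G R D` at `z j` equals `β`.
  let b : ℂ := (β - α * e) * ((q : ℂ) * z j ^ (q - 1))⁻¹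
  have hb : ‖b‖ ≤ ‖β‖ + ‖α‖ * (2 * ∑ k ∈ t, r k + 1) := by
    simp only [b, norm_mul, norm_inv, norm_pow, hz, one_pow, Complex.norm_natCast, mul_one]
    rw [← div_eq_mul_inv, div_le_iff₀ hq0]
    refine (norm_sub_le _ _).trans ?_
    rw [norm_mul]
    have h1 := mul_le_mul_of_nonneg_left he (norm_nonneg α)
    have h2 := mul_le_mul_of_nonneg_left hq1 (norm_nonneg β)
    linarith
  let R : ℂ[X] := C α + C b * (X ^ q - C (w j))
  refine ⟨G * (R * D), ?_, ?_, ?_, ?_⟩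
  -- With `s` nodes the degree is at most `2 q (s - 1) + q + (q - 1) < 2 q s ≤ 2N`.
  · have hF : ∀ k, (F k).natDegree ≤ q := fun k => by
      refine (natDegree_C_mul_le _ _).trans ((natDegree_sub_le _ _).trans ?_)
      simp
    have hG : G.natDegree ≤ t.card * (2 * q) := by
      refine (natDegree_prod_le _ _).trans (Finset.sum_le_card_nsmul _ _ _ fun k _ => ?_)
      exact natDegree_pow_le.trans (Nat.mul_le_mul_left 2 (hF k))
    have hR : R.natDegree ≤ q := by
      refine (natDegree_add_le _ _).trans ?_
      rw [natDegree_C, max_eq_right (Nat.zero_le _)]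
      refine (natDegree_C_mul_le _ _).trans ((natDegree_sub_le _ _).trans ?_)
      simp
    have hD : D.natDegree ≤ q - 1 := natDegree_averagingPolynomial_le
    have hcard : t.card + 1 = Fintype.card ι := by
      rw [ht, Finset.card_erase_add_one (Finset.mem_univ j), Finset.card_univ]
    have h1 := (natDegree_mul_le (p := G) (q := R * D)).trans
      (Nat.add_le_add hG ((natDegree_mul_le (p := R) (q := D)).trans (Nat.add_le_add hR hD)))
    rw [← hcard] at hqN
    have h2 : t.card * (2 * q) = 2 * (t.card * q) := by ring
    have h3 : (t.card + 1) * q = t.card * q + q := by ring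
    omega
  · intro k
    split_ifs with hk
    · subst hk
      simp [hGj, hDj, R, w]
    · obtain ⟨S, hS⟩ := hGk k hk
      simp [hS]
  · intro k
    split_ifs with hk
    · subst hk
      have : (q : ℂ) * z k ^ (q - 1) ≠ 0 := mul_ne_zero hqC (pow_ne_zero _ (hz0 k))
      have h1 : b * ((q : ℂ) * z k ^ (q - 1)) = β - α * e := by
        simp only [b]; rw [mul_assoc, inv_mul_cancel₀ this, mul_one]
      have hR : R.eval (z k) = α := by simp [R, w]
      have hR' : R.derivative.eval (z k) = b * ((q : ℂ) * z k ^ (q - 1)) := by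
        simp [R, derivative_X_pow]
      simp only [derivative_mul, eval_add, eval_mul, hGj, hDj, hR, hR', h1, e]
      ring
    · obtain ⟨S, hS⟩ := hGk k hk
      simp [hS, derivative_mul, derivative_pow]
  · intro n
    refine norm_coeff_prod_mul_le (fun n => ?_) t a w r (fun k _ => hw k) (fun k hk => ?_) q n
    · have hD := fun n => norm_coeff_averagingPolynomial_le (q := q) (hz j) n
      have h1 := norm_coeff_C_mul_le hD α n
      have h2 := norm_coeff_C_mul_le (norm_coeff_X_pow_sub_C_mul_le hD (hw j) q) b n
      have h3 : R * D = C α * D + C b * ((X ^ q - C (w j)) * D) := by simp only [R]; ring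
      rw [h3, coeff_add]
      refine (norm_add_le _ _).trans ((add_le_add h1 h2).trans ?_)
      have h4 : ‖b‖ * (2 * (q : ℝ)⁻¹) ≤
          (‖β‖ + ‖α‖ * (2 * ∑ k ∈ t, r k + 1)) * (2 * (q : ℝ)⁻¹) := by gcongr
      linarith
    · simp only [a, norm_inv]; exact hr k (Finset.ne_of_mem_erase hk)

/-! ### Duality with the confluent Vandermonde matrix. -/

/-- The normalization is left uncancelled so that the identity also covers `N = 0`. -/
theorem confluentVandermonde_mulVec_apply {s : ℕ} (N : ℕ) (ξ : Fin s → ℝ)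
    (c : Fin s × Fin 2 → ℂ) (k : Fin (2 * N + 1)) :
    ((√(2 * (N : ℝ)) : ℝ) : ℂ) * ((confluentVandermonde N ξ).mulVec c k) =
      ((√(2 * (N : ℝ)) * (1 / √(2 * (N : ℝ))) : ℝ) : ℂ) *
      ∑ i, (c (i, 0) * Complex.exp (Complex.I * ξ i) ^ (k : ℕ) +
        c (i, 1) * ((k : ℕ) * Complex.exp (Complex.I * ξ i) ^ ((k : ℕ) - 1))) := by
  simp only [Matrix.mulVec, dotProduct, confluentVandermonde, Matrix.of_apply,
    Fintype.sum_prod_type, Fin.sum_univ_two, Finset.mul_sum, if_true, Fin.isValue, one_ne_zero,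
    if_false, Complex.ofReal_mul]
  refine Finset.sum_congr rfl fun i _ => ?_
  ring

open Polynomial in
/-- An interpolating polynomial gives a lower bound for the confluent Vandermonde matrix. -/
theorem norm_le_of_hermite_interpolant {s N : ℕ} (hN : 1 ≤ N) (ξ : Fin s → ℝ) (j : Fin s)
    (α β : ℂ) (P : ℂ[X]) (hdeg : P.natDegree ≤ 2 * N)
    (h0 : ∀ k, P.eval (Complex.exp (Complex.I * ξ k)) = if k = j then α else 0)
    (h1 : ∀ k, P.derivative.eval (Complex.exp (Complex.I * ξ k)) = if k = j then β else 0)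
    {M : ℝ} (hM : ∀ n, ‖P.coeff n‖ ≤ M) (c : EuclideanSpace ℂ (Fin s × Fin 2)) :
    ‖α * c (j, 0) + β * c (j, 1)‖ ≤
      3 * N * M * ‖Matrix.toEuclideanLin (confluentVandermonde N ξ) c‖ := by
  set y := Matrix.toEuclideanLin (confluentVandermonde N ξ) c with hy
  have hN' : (1 : ℝ) ≤ N := by exact_mod_cast hN
  have hM0 : 0 ≤ M := (norm_nonneg _).trans (hM 0)
  have hsqrt : √(2 * (N : ℝ)) ≠ 0 := by positivity
  have hyk : ∀ k, ((√(2 * (N : ℝ)) : ℝ) : ℂ) * y k =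
      ∑ i, (c (i, 0) * Complex.exp (Complex.I * ξ i) ^ (k : ℕ) +
        c (i, 1) * ((k : ℕ) * Complex.exp (Complex.I * ξ i) ^ ((k : ℕ) - 1))) := by
    intro k
    have h := confluentVandermonde_mulVec_apply N ξ c k
    rw [mul_one_div_cancel hsqrt, Complex.ofReal_one, one_mul] at h
    exact h
  -- Exchanging the sums turns each column into a value of `P` or of its derivative, and only node
  -- `j` survives.
  have hrec : α * c (j, 0) + β * c (j, 1) =
      ∑ k : Fin (2 * N + 1), P.coeff k * (((√(2 * (N : ℝ)) : ℝ) : ℂ) * y k) := by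
    simp only [hyk, Finset.mul_sum]
    rw [Finset.sum_comm]
    have h : ∀ i, ∑ k : Fin (2 * N + 1), P.coeff k *
        (c (i, 0) * Complex.exp (Complex.I * ξ i) ^ (k : ℕ) +
        c (i, 1) * ((k : ℕ) * Complex.exp (Complex.I * ξ i) ^ ((k : ℕ) - 1))) =
        c (i, 0) * (if i = j then α else 0) + c (i, 1) * (if i = j then β else 0) := by
      intro i
      rw [← h0, ← h1, ← sum_coeff_mul_eq_eval P (Nat.lt_succ_of_le hdeg),
        ← sum_coeff_mul_eq_derivative_eval P (Nat.lt_succ_of_le hdeg), Finset.mul_sum,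
        Finset.mul_sum, ← Finset.sum_add_distrib]
      exact Finset.sum_congr rfl fun k _ => by ring
    rw [Finset.sum_congr rfl fun i _ => h i, Finset.sum_add_distrib]
    simp [mul_comm]
  have hsum : ∑ k, ‖y k‖ ≤ √(2 * (N : ℝ) + 1) * ‖y‖ := by
    have h := sq_sum_le_card_mul_sum_sq (s := Finset.univ) (f := fun k => ‖y k‖)
    rw [← EuclideanSpace.norm_sq_eq, Finset.card_univ, Fintype.card_fin] at h
    push_cast at h
    refine le_of_sq_le_sq (h.trans (le_of_eq ?_)) (by positivity)
    rw [mul_pow, Real.sq_sqrt (by positivity)]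
  have hroot : √(2 * (N : ℝ)) * √(2 * (N : ℝ) + 1) ≤ 3 * N := by
    rw [← Real.sqrt_mul (by positivity)]
    refine Real.sqrt_le_iff.2 ⟨by positivity, ?_⟩
    nlinarith
  rw [hrec]
  calc _ ≤ ∑ k : Fin (2 * N + 1), M * (√(2 * (N : ℝ)) * ‖y k‖) := by
        refine (norm_sum_le _ _).trans (Finset.sum_le_sum fun k _ => ?_)
        rw [norm_mul, norm_mul, Complex.norm_real, Real.norm_of_nonneg (Real.sqrt_nonneg _)]
        exact mul_le_mul_of_nonneg_right (hM _) (by positivity)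
    _ = M * (√(2 * (N : ℝ)) * ∑ k, ‖y k‖) := by rw [Finset.mul_sum, Finset.mul_sum]
    _ ≤ M * (√(2 * (N : ℝ)) * (√(2 * (N : ℝ) + 1) * ‖y‖)) := by gcongr
    _ = M * (√(2 * (N : ℝ)) * √(2 * (N : ℝ) + 1)) * ‖y‖ := by ring
    _ ≤ M * (3 * N) * ‖y‖ := by gcongr
    _ = _ := by ring

/-! ### Separation of the nodes and bounds on single entries. -/

/-- For each node of a clustered configuration there is a decimation factor that spreads its
cluster to scale `N Δ` and keeps the node away from all nodes outside the cluster. -/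
theorem exists_separating_power {s ℓ N : ℕ} {Δ ρ τ : ℝ} {ξ : Fin s → ℝ} (hρ : 0 < ρ)
    (hξ : ∀ j, ξ j ∈ Set.Ioc (1 / (s : ℝ) ^ 2 * (-(π / 2))) (1 / (s : ℝ) ^ 2 * (π / 2)))
    (hc : IsClusteredConfiguration Δ ρ s ℓ τ ξ)
    (hN1 : 4 * π * (s : ℝ) / ρ ≤ N) (hN2 : 4 * (s : ℝ) ^ 3 ≤ (N : ℝ))
    (hN3 : (N : ℝ) ≤ π * (s : ℝ) / (τ * Δ)) (j : Fin s) :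
    ∃ (q : ℕ) (c : Finset (Fin s)), (N : ℝ) / (2 * s) ≤ q ∧ (q : ℝ) ≤ N / s ∧ j ∈ c ∧ c.card ≤ ℓ ∧
      ∀ k, k ≠ j → 1 / (6 * (s : ℝ) * if k ∈ c then π * s / (N * Δ) else 1) ≤
        ‖Complex.exp (Complex.I * ξ j) ^ q - Complex.exp (Complex.I * ξ k) ^ q‖ := by
  obtain ⟨c, hjc, hcard, hin, hout⟩ := hc.cluster j
  have hs : 2 ≤ s := hc.two_le_ℓ.trans hc.ℓ_le_s
  have hs' : (2 : ℝ) ≤ s := by exact_mod_cast hs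
  have hN0 : (0 : ℝ) < N := lt_of_lt_of_le (by positivity) hN2
  have hΔ := hc.Δ_pos
  have hτ : 1 ≤ τ := by
    have h1 : (2 : ℝ) ≤ ℓ := by exact_mod_cast hc.two_le_ℓ
    linarith [hc.le_τ]
  have hpi := Real.pi_pos
  have hdist : ∀ k, |ξ k - ξ j| ≤ π / s ^ 2 := by
    intro k
    obtain ⟨h1, h2⟩ := hξ k
    obtain ⟨h3, h4⟩ := hξ j
    have h5 : 1 / (s : ℝ) ^ 2 * (π / 2) + 1 / (s : ℝ) ^ 2 * (π / 2) = π / s ^ 2 := by ring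
    rw [mul_neg] at h1 h3
    rw [abs_le]
    constructor <;> linarith
  have hwrap : ∀ k, wrapNorm (ξ k - ξ j) = |ξ k - ξ j| := fun k =>
    wrapNorm_eq_abs ((hdist k).trans_lt (div_lt_self hpi (by nlinarith)))
  have hcompl : cᶜ.card + 1 ≤ s := by
    have h1 := Finset.card_pos.2 ⟨j, hjc⟩
    have h2 := Finset.card_compl_add_card c
    rw [Fintype.card_fin] at h2
    omega
  -- Angles are measured in full turns: `q x` is near an integer exactly when the two `q`-th powers
  -- are close. The lower bound on `x` comes from `ρ ≥ 4 π s / N`, the upper one from the shrinking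
  -- of the nodes by `1 / s²`.
  obtain ⟨q, hq1, hq2, hq3⟩ := exists_decimation hs hN2 cᶜ hcompl
    (fun k => |ξ k - ξ j| / (2 * π)) (fun k hk => by
      have h1 := hout k (Finset.mem_compl.1 hk)
      rw [hwrap] at h1
      constructor
      · rw [div_le_div_iff₀ hN0 (by positivity)]
        rw [div_le_iff₀ hρ] at hN1
        nlinarith
      · have h2 := hdist k
        rw [le_div_iff₀ (by positivity)] at h2
        rw [div_le_div_iff₀ (by positivity) (by positivity)]
        linarith)
  refine ⟨q, c, hq1, hq2, hjc, hcard, fun k hkj => ?_⟩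
  have hnorm : ‖Complex.exp (Complex.I * ξ j) ^ q - Complex.exp (Complex.I * ξ k) ^ q‖
      = 2 * |Real.sin (q * |ξ k - ξ j| / 2)| := by
    rw [← Complex.exp_nat_mul, ← Complex.exp_nat_mul]
    have h := norm_exp_sub_exp_eq (q * ξ j) (q * ξ k)
    push_cast at h
    rw [mul_left_comm, mul_left_comm (q : ℂ), h, ← mul_sub]
    rcases abs_choice (ξ k - ξ j) with h1 | h1 <;> rw [h1]
    rw [mul_neg, neg_div, Real.sin_neg, abs_neg]
  rw [hnorm]
  split_ifs with hk
  · obtain ⟨h1, h2⟩ := hin k hk hkj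
    rw [hwrap] at h1 h2
    -- The upper bound on `N` prevents wraparound inside the cluster, so Jordan's inequality applies
    -- to the half angle.
    have h3 : (q : ℝ) * |ξ k - ξ j| ≤ π := by
      calc (q : ℝ) * |ξ k - ξ j| ≤ (N / s) * (τ * Δ) := by gcongr
        _ ≤ (π * s / (τ * Δ) / s) * (τ * Δ) := by gcongr
        _ = π := by field_simp
    have h4 := Real.mul_abs_le_abs_sin (x := q * |ξ k - ξ j| / 2) (by
      rw [abs_of_nonneg (by positivity)]; linarith)
    rw [abs_of_nonneg (a := q * |ξ k - ξ j| / 2) (by positivity)] at h4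
    calc 1 / (6 * (s : ℝ) * (π * s / (N * Δ))) ≤ 1 / (1 * (π * s / (N * Δ))) := by
          gcongr; linarith
      _ = 2 * (2 / π * (N / (2 * s) * Δ / 2)) := by field_simp
      _ ≤ 2 * (2 / π * (q * |ξ k - ξ j| / 2)) := by gcongr
      _ ≤ _ := by gcongr
  · have h1 := le_abs_sin_pi_mul_of_far_from_integers (hq3 k (Finset.mem_compl.2 hk))
    have h2 : π * (q * (|ξ k - ξ j| / (2 * π))) = q * |ξ k - ξ j| / 2 := by field_simp
    rw [h2] at h1
    calc 1 / (6 * (s : ℝ) * 1) = 2 * (2 * (1 / (24 * s))) := by field_simp; norm_num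
      _ ≤ _ := by gcongr

/-- At most `ℓ - 1` cluster members differ from `j`, and only they contribute a factor `T ^ 2`. -/
theorem prod_erase_ite_sq_le {ι : Type*} [Fintype ι] [DecidableEq ι] (c : Finset ι) {j : ι}
    (hj : j ∈ c) {ℓ : ℕ} (hc : c.card ≤ ℓ) {T K : ℝ} (hT : 1 ≤ T) (hK : 1 ≤ K) :
    ∏ k ∈ Finset.univ.erase j, (2 * (K * if k ∈ c then T else 1)) ^ 2 ≤
      (2 * K) ^ (2 * Fintype.card ι) * T ^ (2 * (ℓ - 1)) := by
  have h1 : ∀ k ∈ Finset.univ.erase j, (2 * (K * if k ∈ c then T else 1)) ^ 2 =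
      (2 * K) ^ 2 * if k ∈ c then T ^ 2 else 1 := by
    intro k _
    split_ifs <;> ring
  rw [Finset.prod_congr rfl h1, Finset.prod_mul_distrib, Finset.prod_const, Finset.prod_ite,
    Finset.prod_const, Finset.prod_const_one, mul_one, ← pow_mul, ← pow_mul]
  have h2 : ((Finset.univ.erase j).filter (· ∈ c)).card ≤ ℓ - 1 := by
    have h3 : (Finset.univ.erase j).filter (· ∈ c) ⊆ c.erase j := by
      intro k hk
      simp only [Finset.mem_filter, Finset.mem_erase] at hk ⊢
      exact ⟨hk.1.1, hk.2⟩
    have h4 := Finset.card_le_card h3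
    rw [Finset.card_erase_of_mem hj] at h4
    omega
  have h5 : (Finset.univ.erase j).card ≤ Fintype.card ι := Finset.card_le_univ _
  gcongr
  linarith

/-- The entries of a vector are controlled by its image under the confluent Vandermonde matrix. -/
theorem norm_entry_le {s ℓ N : ℕ} {Δ ρ τ : ℝ} {ξ : Fin s → ℝ} (hρ : 0 < ρ)
    (hξ : ∀ j, ξ j ∈ Set.Ioc (1 / (s : ℝ) ^ 2 * (-(π / 2))) (1 / (s : ℝ) ^ 2 * (π / 2)))
    (hc : IsClusteredConfiguration Δ ρ s ℓ τ ξ)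
    (hN1 : 4 * π * (s : ℝ) / ρ ≤ N) (hN2 : 4 * (s : ℝ) ^ 3 ≤ (N : ℝ))
    (hN3 : (N : ℝ) ≤ π * (s : ℝ) / (τ * Δ)) (x : EuclideanSpace ℂ (Fin s × Fin 2))
    (i : Fin s × Fin 2) :
    ‖x i‖ ≤ 6 * s * (12 * s) ^ (2 * s) * (5 + 24 * s ^ 2) * (π * s / (N * Δ)) ^ (2 * ℓ - 1) *
      ‖Matrix.toEuclideanLin (confluentVandermonde N ξ) x‖ := by
  obtain ⟨j, p⟩ := i
  have hs : 2 ≤ s := hc.two_le_ℓ.trans hc.ℓ_le_s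
  have hs' : (2 : ℝ) ≤ s := by exact_mod_cast hs
  have hN0 : (0 : ℝ) < N := lt_of_lt_of_le (by positivity) hN2
  have hΔ := hc.Δ_pos
  have hpi := Real.pi_pos
  have hτ : 1 ≤ τ := by
    have h1 : (2 : ℝ) ≤ ℓ := by exact_mod_cast hc.two_le_ℓ
    linarith [hc.le_τ]
  set T : ℝ := π * s / (N * Δ) with hT
  -- `T ≥ 1` lets additive constants be absorbed into multiples of `T`.
  have hT1 : 1 ≤ T := by
    rw [le_div_iff₀ (by positivity)] at hN3
    rw [hT, one_le_div (by positivity)]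
    have : (N : ℝ) * Δ * 1 ≤ N * Δ * τ := by gcongr
    linarith
  obtain ⟨q, c, hq1, hq2, hjc, hcard, hsep⟩ :=
    exists_separating_power hρ hξ hc hN1 hN2 hN3 j
  have hq0 : (0 : ℝ) < q := lt_of_lt_of_le (by positivity) hq1
  have hqN : Fintype.card (Fin s) * q ≤ N := by
    rw [le_div_iff₀ (by positivity)] at hq2
    rw [Fintype.card_fin, mul_comm]
    exact_mod_cast hq2
  let r : Fin s → ℝ := fun k => 6 * s * if k ∈ c then T else 1
  have hr0 : ∀ k, 0 < r k := fun k => by simp only [r]; split_ifs <;> positivity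
  have hrT : ∀ k, r k ≤ 6 * s * T := fun k => by
    simp only [r]; split_ifs
    · exact le_rfl
    · gcongr
  let α : ℂ := if p = 0 then 1 else 0
  let β : ℂ := if p = 0 then 0 else 1
  have hα : ‖α‖ ≤ 1 := by simp only [α]; split_ifs <;> simp
  have hβ : ‖β‖ ≤ 1 := by simp only [β]; split_ifs <;> simp
  have hx : α * x (j, 0) + β * x (j, 1) = x (j, p) := by
    fin_cases p <;> simp [α, β]
  obtain ⟨P, hP1, hP2, hP3, hP4⟩ := exists_hermite_interpolant (q := q) (N := N)
    (by exact_mod_cast hq0.ne') hqN (fun k => Complex.exp (Complex.I * ξ k))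
    (fun k => by rw [mul_comm, Complex.norm_exp_ofReal_mul_I]) j r
    (fun k hk h => by
      have h1 := hsep k hk
      rw [h, sub_self, norm_zero] at h1
      exact absurd h1 (not_le.2 (one_div_pos.2 (hr0 k))))
    (fun k hk => by
      have h1 := hsep k hk
      rw [one_div] at h1
      exact inv_le_of_inv_le₀ (hr0 k) h1) α β
  have hbound : ∀ n, ‖P.coeff n‖ ≤ (12 * s) ^ (2 * s) * T ^ (2 * (ℓ - 1)) *
      (((5 + 24 * s ^ 2) * T) * (2 * s / N)) := by
    intro n
    refine (hP4 n).trans ?_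
    clear_value α β
    have h1 := prod_erase_ite_sq_le c hjc hcard hT1 (K := 6 * s) (by linarith)
    rw [Fintype.card_fin, show 2 * (6 * (s : ℝ)) = 12 * s by ring] at h1
    have h2 : ∑ k ∈ Finset.univ.erase j, r k ≤ s * (6 * s * T) := by
      refine (Finset.sum_le_card_nsmul _ _ _ fun k _ => hrT k).trans ?_
      rw [nsmul_eq_mul]
      gcongr
      exact (Finset.card_le_univ _).trans_eq (Fintype.card_fin s)
    have h3 : 0 ≤ ∑ k ∈ Finset.univ.erase j, r k := Finset.sum_nonneg fun k _ => (hr0 k).le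
    have h4 : ‖α‖ + 2 * (‖β‖ + ‖α‖ * (2 * ∑ k ∈ Finset.univ.erase j, r k + 1)) ≤
        (5 + 24 * s ^ 2) * T := by
      have h5 : ‖α‖ * (2 * ∑ k ∈ Finset.univ.erase j, r k + 1) ≤
          1 * (2 * ∑ k ∈ Finset.univ.erase j, r k + 1) := by gcongr
      linarith
    have h6 : (q : ℝ)⁻¹ ≤ 2 * s / N := by
      rw [← inv_div]
      exact inv_anti₀ (by positivity) hq1
    refine mul_le_mul h1 ?_ ?_ (by positivity)
    · exact mul_le_mul h4 h6 (by positivity) (by positivity)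
    · generalize ∑ k ∈ Finset.univ.erase j, r k = S at h3
      positivity
  have hN : 1 ≤ N := by exact_mod_cast hN0
  have h := norm_le_of_hermite_interpolant hN ξ j α β P hP1 hP2 hP3 hbound x
  rw [hx] at h
  refine h.trans (le_of_eq ?_)
  -- The last `T` is the price of the derivative correction, through the sum of the `r k`.
  have hpow : T ^ (2 * ℓ - 1) = T ^ (2 * (ℓ - 1)) * T := by
    rw [← pow_succ]
    congr 1
    have := hc.two_le_ℓ
    omega
  rw [hpow]
  generalize T ^ (2 * (ℓ - 1)) = t₁
  generalize (12 * (s : ℝ)) ^ (2 * s) = t₂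
  generalize T = t₃
  field_simp
  ring

/-! ### From entries to the smallest singular value. -/

theorem theorem3p1 (s : ℕ) :
    ∃ C₁ : ℝ, 0 < C₁ ∧
      ∀ (Δ ρ τ : ℝ) (ℓ N : ℕ) (ξ : Fin s → ℝ),
        4 * τ * Δ ≤ min ρ (1 / (s : ℝ) ^ 2) →
        (∀ j, ξ j ∈ Set.Ioc (1 / (s : ℝ) ^ 2 * (-(π / 2))) (1 / (s : ℝ) ^ 2 * (π / 2))) →
        IsClusteredConfiguration Δ ρ s ℓ τ ξ →
        max (4 * π * (s : ℝ) / ρ) (4 * (s : ℝ) ^ 3) ≤ (N : ℝ) →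
        (N : ℝ) ≤ π * (s : ℝ) / (τ * Δ) →
        C₁ * ((N : ℝ) * Δ) ^ (2 * ℓ - 1) ≤ sigmaMin (confluentVandermonde N ξ) := by
  set A : ℝ := 6 * s * (12 * s) ^ (2 * s) * (5 + 24 * s ^ 2) with hA
  set B : ℝ := 2 * s * A * (π * s) ^ (2 * s) with hB
  have hpi := Real.pi_pos
  have hA0 : 0 ≤ A := by positivity
  have hB0 : 0 ≤ B := by positivity
  -- Adding `1` keeps the constant positive for `s = 0`, where `B = 0`.
  refine ⟨(1 + B)⁻¹, by positivity, fun Δ ρ τ ℓ N ξ h4 hξ hc hN hN3 => ?_⟩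
  have hs : 2 ≤ s := hc.two_le_ℓ.trans hc.ℓ_le_s
  have hs' : (2 : ℝ) ≤ s := by exact_mod_cast hs
  have hN1 := (le_max_left _ _).trans hN
  have hN2 := (le_max_right _ _).trans hN
  have hN0 : (0 : ℝ) < N := lt_of_lt_of_le (by positivity) hN2
  have hΔ := hc.Δ_pos
  have hτ : 1 ≤ τ := by
    have h1 : (2 : ℝ) ≤ ℓ := by exact_mod_cast hc.two_le_ℓ
    linarith [hc.le_τ]
  have hρ : 0 < ρ := lt_of_lt_of_le (by positivity) (h4.trans (min_le_left _ _))
  -- The matrix has at least as many rows as columns, so the index in `sigmaMin` is `2 s - 1`.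
  have hsN : 2 * s ≤ 2 * N + 1 := by
    have h1 : (s : ℝ) ≤ N := le_trans (by nlinarith [sq_nonneg (s : ℝ)]) hN2
    have h2 : s ≤ N := by exact_mod_cast h1
    omega
  rw [sigmaMin]
  refine le_singularValues_of_forall_norm_le _ (fun x => ?_) ?_
  · set y := Matrix.toEuclideanLin (confluentVandermonde N ξ) x with hy
    set D : ℝ := ((N : ℝ) * Δ) ^ (2 * ℓ - 1) with hD
    have hD0 : 0 < D := by positivity
    have hx : ‖x‖ ≤ ∑ i, ‖x i‖ := by
      have h := norm_sum_le Finset.univ fun i => EuclideanSpace.single i (x i)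
      have hsingle : ∑ i, EuclideanSpace.single i (x i) = x := by
        ext i
        simp [Finset.sum_apply, Pi.single_apply]
      rw [hsingle] at h
      simpa only [PiLp.norm_single] using h
    have hsum : ∑ i, ‖x i‖ ≤ 2 * s * (A * (π * s / (N * Δ)) ^ (2 * ℓ - 1) * ‖y‖) := by
      refine (Finset.sum_le_card_nsmul _ _ _
        fun i _ => norm_entry_le hρ hξ hc hN1 hN2 hN3 x i).trans (le_of_eq ?_)
      rw [nsmul_eq_mul, Finset.card_univ, Fintype.card_prod, Fintype.card_fin, Fintype.card_fin]
      push_cast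
      ring
    -- Since `π s ≥ 1` and `2ℓ - 1 ≤ 2s`, the dependence of the constant on `ℓ` disappears.
    have hpow : (π * s / (N * Δ)) ^ (2 * ℓ - 1) ≤ (π * s) ^ (2 * s) / D := by
      rw [div_pow]
      gcongr
      · nlinarith [Real.pi_gt_three]
      · have := hc.ℓ_le_s
        omega
    have hfin : ‖x‖ ≤ B / D * ‖y‖ := by
      calc ‖x‖ ≤ 2 * s * (A * (π * s / (N * Δ)) ^ (2 * ℓ - 1) * ‖y‖) := hx.trans hsum
        _ ≤ 2 * s * (A * ((π * s) ^ (2 * s) / D) * ‖y‖) := by gcongr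
        _ = B / D * ‖y‖ := by rw [hB]; ring
    calc (1 + B)⁻¹ * D * ‖x‖ ≤ (1 + B)⁻¹ * D * (B / D * ‖y‖) := by gcongr
      _ = (1 + B)⁻¹ * B * ‖y‖ := by field_simp
      _ ≤ 1 * ‖y‖ := by
        gcongr
        rw [inv_mul_le_iff₀ (by positivity)]
        linarith
      _ = ‖y‖ := one_mul _
  · rw [finrank_euclideanSpace]
    simp only [Fintype.card_prod, Fintype.card_fin]
    omega
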